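/- Let $k\ge 0$ and let $M_k=(\mathrm{Sym}^2(\mathbb R^k)\otimes\mathbb H)\oplus\mathbb H^k$, whose elements are pairs $(T,P)$ of a $k\times k$ quaternionic matrix $T$ with $T^{\top}=T$ and a quaternionic column vector $P$. Let $O(k)$ act on $M_k$ by $u\cdot(T,P)=(uTu^{-1},uP)$. Say that $(T,P)$ satisfies the ADHM condition if every entry of the matrix $T^*T+PP^*$ has zero quaternionic imaginary part ($*$ is the quaternionic conjugate transpose), and that it is nondegenerate if for every $x\in\mathbb R^4=\mathbb H$ the map $$\mathcal R_x:\mathbb H^k\oplus\mathbb H\to\mathbb H^k,\qquad (v,q)\mapsto (T-x\mathbf 1)^*v+Pq,$$ is surjective. Let $A_k\subset M_k$ be the set of nondegenerate $(T,P)$ satisfying the ADHM condition. Then: 1. If $(T,P)\in M_k$ is fixed by some $u\in O(k)$ with $u\neq 1$, then there are $l\ge 0$, $m\ge 1$ with $l+m=k$ such that, in a suitable orthonormal basis of $\mathbb R^k$, $$T=\begin{pmatrix}T'&0\\0&T''\end{pmatrix},\qquad P=\begin{pmatrix}P'\\0\end{pmatrix},$$ with $(T',P')\in M_l$ and $T''\in\mathrm{Sym}^2(\mathbb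 R^m)\otimes\mathbb H$. Moreover $(T,P)$ is not nondegenerate; in particular $(T,P)\notin A_k$. 2. If $(T,P)\in M_k$ satisfies the ADHM condition, then $(T,P)$ is nondegenerate if and only if its stabiliser in $O(k)$ is trivial. 3. The action of $O(k)$ preserves $A_k$, and it is free on $A_k$. -/

import Mathlib

open scoped Quaternion Matrix

/-- `(Sym²(ℝᵏ) ⊗ ℍ) ⊕ ℍᵏ`: pairs of a symmetric quaternionic matrix `T` (that is, `Tᵀ = T`, with no
conjugation) and a quaternionic column vector `P`. -/
@[ext]
structure ADHMSpace (k : ℕ) where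
  T : Matrix (Fin k) (Fin k) ℍ[ℝ]
  symm : T.IsSymm
  P : Fin k → ℍ[ℝ]

namespace ADHMSpace

/-- A real matrix regarded as a quaternionic matrix. -/
def toQuat {k : ℕ} : Matrix (Fin k) (Fin k) ℝ →+* Matrix (Fin k) (Fin k) ℍ[ℝ] :=
  (algebraMap ℝ ℍ[ℝ]).mapMatrix

theorem toQuat_transpose {k : ℕ} (g : Matrix (Fin k) (Fin k) ℝ) : toQuat gᵀ = (toQuat g)ᵀ := rfl

/-- Transposition reverses products with a real factor on the left. -/
theorem transpose_toQuat_mul {k : ℕ} (g : Matrix (Fin k) (Fin k) ℝ)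
    (A : Matrix (Fin k) (Fin k) ℍ[ℝ]) : (toQuat g * A)ᵀ = Aᵀ * (toQuat g)ᵀ := by
  ext1 i j
  simp only [Matrix.transpose_apply, Matrix.mul_apply]
  exact Finset.sum_congr rfl fun a _ => Algebra.commutes (g j a) (A a i)

/-- Transposition reverses products with a real factor on the right. -/
theorem transpose_mul_toQuat {k : ℕ} (g : Matrix (Fin k) (Fin k) ℝ)
    (A : Matrix (Fin k) (Fin k) ℍ[ℝ]) : (A * toQuat g)ᵀ = (toQuat g)ᵀ * Aᵀ := by
  ext1 i j
  simp only [Matrix.transpose_apply, Matrix.mul_apply]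
  exact Finset.sum_congr rfl fun a _ => (Algebra.commutes (g a i) (A j a)).symm

theorem toQuat_inv {k : ℕ} (g : Matrix.orthogonalGroup (Fin k) ℝ) :
    toQuat ((g⁻¹ : Matrix.orthogonalGroup (Fin k) ℝ) : Matrix (Fin k) (Fin k) ℝ) =
      (toQuat (g : Matrix (Fin k) (Fin k) ℝ))ᵀ := rfl

/-- The action `g · (T, P) = (g T g⁻¹, g P)` of `O(k)`. -/
noncomputable instance {k : ℕ} : MulAction (Matrix.orthogonalGroup (Fin k) ℝ) (ADHMSpace k) where
  smul g d :=
    { T := toQuat g * d.T * toQuat (g⁻¹ : Matrix.orthogonalGroup (Fin k) ℝ)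
      symm := by
        rw [Matrix.IsSymm, transpose_mul_toQuat, transpose_toQuat_mul, toQuat_inv,
          Matrix.transpose_transpose, d.symm.eq, Matrix.mul_assoc]
      P := toQuat g *ᵥ d.P }
  one_smul d := by
    apply ADHMSpace.ext
    · change toQuat _ * d.T * toQuat _ = d.T
      simp
    · change toQuat _ *ᵥ d.P = d.P
      simp
  mul_smul g h d := by
    apply ADHMSpace.ext
    · change toQuat _ * d.T * toQuat _ = toQuat _ * (toQuat _ * d.T * toQuat _) * toQuat _
      simp [Matrix.mul_assoc]
    · change toQuat _ *ᵥ d.P = toQuat _ *ᵥ (toQuat _ *ᵥ d.P)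
      simp

variable {k : ℕ}

/-- The ADHM condition `Im (T* T + P P*) = 0`, the imaginary part being taken entrywise. -/
def SatisfiesADHM (d : ADHMSpace k) : Prop :=
  ∀ i j, ((d.Tᴴ * d.T + Matrix.vecMulVec d.P (star d.P)) i j).im = 0

/-- The map `R_x = ((T - x 1)*, P) : ℍᵏ ⊕ ℍ → ℍᵏ`, for `x ∈ ℝ⁴ = ℍ`. -/
noncomputable def R (d : ADHMSpace k) (x : ℍ[ℝ]) (v : (Fin k → ℍ[ℝ]) × ℍ[ℝ]) : Fin k → ℍ[ℝ] :=
  (d.T - Matrix.diagonal fun _ => x)ᴴ *ᵥ v.1 + fun i => d.P i * v.2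

/-- The nondegeneracy condition. -/
def Nondegenerate (d : ADHMSpace k) : Prop :=
  ∀ x : ℍ[ℝ], Function.Surjective (d.R x)

/-- After an orthogonal change of basis of `ℝᵏ`, and with respect to a splitting `k = l + m` with
`m > 0`, one has `T = diag(T', T'')` and `P = (P', 0)`, where `(T', P')` lies in the space of
index `l` and `T''` is a symmetric quaternionic `m × m` matrix. -/
def Splits (d : ADHMSpace k) : Prop :=
  ∃ (l m : ℕ) (e : Fin l ⊕ Fin m ≃ Fin k) (g : Matrix.orthogonalGroup (Fin k) ℝ)
    (d' : ADHMSpace l) (T'' : Matrix (Fin m) (Fin m) ℍ[ℝ]),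
    0 < m ∧ T''.IsSymm ∧
      (g • d).T.submatrix e e = Matrix.fromBlocks d'.T 0 0 T'' ∧
      (g • d).P ∘ e = Sum.elim d'.P 0

/-- The data satisfying both the ADHM condition and the nondegeneracy condition. -/
def nondegenerateData (k : ℕ) : Set (ADHMSpace k) :=
  {d | d.SatisfiesADHM ∧ d.Nondegenerate}

end ADHMSpace

/-!
Everything rests on the existence of left eigenvalues of quaternionic matrices: for every
`S ∈ Mat_n(ℍ)` with `n ≥ 1` there is `x ∈ ℍ` such that `S - x 1` is not invertible
(`exists_not_isUnit_sub_scalar`). This is a topological fact. If `S - x 1` were always invertible,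
the map `x ↦ x 1` from the `3`-sphere to `GL_n(ℍ)` would be null-homotopic, whereas its class in
`π₃(GL_n(ℍ)) = ℤ` is `± n`. Instead of computing a homotopy group, the degree is expressed as
an integral. With `G = (∑ y_μ e_μ - S)⁻¹` and a trace `τ`, the `3`-form
`τ (G dX G dX G dX)`, `X = ∑ y_μ e_μ`, is closed: its exterior derivative alternates
`τ (G e_a G e_b G e_c G e_d)`, and that alternation vanishes since `τ` is cyclic and a `4`-cycle is
odd. Written as a vector field (`windingField`) it is divergence free
(`sum_fderiv_windingField`), so by the divergence theorem its flux through the boundary of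
`[-1, 1]⁴` is zero. Replacing `S` by `t S` and letting `t → 0` gives zero flux for `S = 0`
(`cubeFlux_windingField_limit_eq_zero`). But for `S = 0` the field is
`-2 n y / |y|⁴` (`windingField_inverse_scalar`), which has negative flux.

If `u ≠ 1` fixes `(T, P)`, the nonzero real symmetric matrix `(1 - u) + (1 - uᵀ)` commutes with `T`
and kills `P`. Diagonalising it over `ℝ` splits `(T, P)` into the part on its kernel, which contains
`P`, and a nonempty block `T''` on the other eigenspaces (`ADHMSpace.splits_of_smul_eq`). A left
eigenvalue of `T''*` then shows that `(T, P)` is degenerate (`ADHMSpace.Splits.not_nondegenerate`).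

Conversely, under the ADHM condition `R_x R_x* = (T - x)* (T - x) + P P*` is a real matrix for every
`x`. If `R_x` is not surjective, this matrix is singular and so kills a nonzero real vector `w`,
which satisfies `T w = x w` and `P* w = 0` (`ADHMSpace.exists_real_kernel`). The reflection in the
hyperplane orthogonal to `w` then fixes `(T, P)` (`ADHMSpace.exists_reflection_smul_eq`).
-/

/-! ### A divergence-free field attached to an affine family of units -/

section Winding

variable {A : Type*} [NormedRing A] [NormedAlgebra ℝ A]

/-- The value at `g` of the `3`-form `τ (g dX g dX g dX)` for `X = ∑ y_μ e_μ`, divided by `3` and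
turned into a vector by the Hodge star of `ℝ⁴`. For a tracial `τ` and `g = (∑ y_μ e_μ)⁻¹` its flux
is the analytic winding number of `y ↦ ∑ y_μ e_μ`, up to a constant. -/
noncomputable def windingField (τ : A →L[ℝ] ℝ) (e : Fin 4 → A) (g : A) : Fin 4 → ℝ :=
  let c (a b c : Fin 4) : ℝ := τ (g * e a * (g * e b) * (g * e c))
  ![c 1 2 3 - c 1 3 2, c 0 3 2 - c 0 2 3, c 0 1 3 - c 0 3 1, c 0 2 1 - c 0 1 2]

theorem continuous_windingField (τ : A →L[ℝ] ℝ) (e : Fin 4 → A) (i : Fin 4) :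
    Continuous fun g => windingField τ e g i := by
  fin_cases i <;> simp [windingField] <;> fun_prop

theorem differentiable_windingField (τ : A →L[ℝ] ℝ) (e : Fin 4 → A) (i : Fin 4) :
    Differentiable ℝ fun g => windingField τ e g i := by
  fin_cases i <;> simp [windingField] <;> fun_prop

/-- The derivative of `τ (g a g b g c)` along a curve `g` with `g' = -g d g`, as holds for the
inverse of a curve with velocity `d`. -/
theorem hasDerivAt_trace_mul_mul (τ : A →L[ℝ] ℝ) (a b c d : A) {g : ℝ → A}
    (hg : HasDerivAt g (-(g 0 * d * g 0)) 0) :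
    HasDerivAt (fun s => τ (g s * a * (g s * b) * (g s * c)))
      (-(τ (g 0 * d * (g 0 * a) * (g 0 * b) * (g 0 * c)) +
        τ (g 0 * a * (g 0 * d) * (g 0 * b) * (g 0 * c)) +
        τ (g 0 * a * (g 0 * b) * (g 0 * d) * (g 0 * c)))) 0 := by
  have h := τ.hasFDerivAt.comp_hasDerivAt (0 : ℝ)
    (((hg.mul_const a).mul (hg.mul_const b)).mul (hg.mul_const c))
  refine h.congr_deriv ?_
  rw [← map_add, ← map_add, ← map_neg]
  congr 1
  simp only [Pi.mul_apply]
  noncomm_ring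

variable [CompleteSpace A]

theorem hasDerivAt_inverse_add_smul {x d : A} (hx : IsUnit x) :
    HasDerivAt (fun s : ℝ => Ring.inverse (x + s • d))
      (-(Ring.inverse x * d * Ring.inverse x)) 0 := by
  have hx' : IsUnit (x + (0 : ℝ) • d) := by simpa using hx
  have h₁ := hasFDerivAt_ringInverse (𝕜 := ℝ) hx'.unit
  have h₂ : HasDerivAt (fun s : ℝ => x + s • d) d 0 := by
    simpa using ((hasDerivAt_id (0 : ℝ)).smul_const d).const_add x
  have h := h₁.comp_hasDerivAt (0 : ℝ) h₂
  have e1 : ((hx'.unit⁻¹ : Aˣ) : A) = Ring.inverse x := by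
    rw [← Ring.inverse_unit]; simp
  simp only [neg_apply, ContinuousLinearMap.mulLeftRight_apply, e1] at h
  exact h

theorem differentiableAt_inverse_affine (e : Fin 4 → A) (S : A) (y : Fin 4 → ℝ)
    (h : IsUnit (∑ μ, y μ • e μ - S)) :
    DifferentiableAt ℝ (fun y : Fin 4 → ℝ => Ring.inverse (∑ μ, y μ • e μ - S)) y := by
  have h₁ := (hasFDerivAt_ringInverse (𝕜 := ℝ) h.unit).differentiableAt
  exact DifferentiableAt.comp y (f := fun y : Fin 4 → ℝ => ∑ μ, y μ • e μ - S) h₁ (by fun_prop)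

/-- The divergence is an alternating sum of `τ (G e_a G e_b G e_c G e_d)` over all permutations. It
vanishes because `τ` is invariant under cyclic rotation of the four factors and a `4`-cycle is
odd. -/
theorem sum_fderiv_windingField (τ : A →L[ℝ] ℝ) (hτ : ∀ a b, τ (a * b) = τ (b * a))
    (e : Fin 4 → A) (S : A) (y : Fin 4 → ℝ) (h : IsUnit (∑ μ, y μ • e μ - S)) :
    ∑ i, fderiv ℝ (fun y : Fin 4 → ℝ =>
      windingField τ e (Ring.inverse (∑ μ, y μ • e μ - S)) i) y (Pi.single i 1) = 0 := by
  set x := ∑ μ, y μ • e μ - S with hx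
  set G := Ring.inverse x
  have line (i : Fin 4) (s : ℝ) :
      ∑ μ, (y + s • (Pi.single i 1 : Fin 4 → ℝ)) μ • e μ - S = x + s • e i := by
    simp only [hx, Pi.add_apply, Pi.smul_apply, add_smul, Finset.sum_add_distrib, smul_eq_mul]
    rw [Finset.sum_eq_single i (f := fun μ => (s * (Pi.single i (1 : ℝ) : Fin 4 → ℝ) μ) • e μ)]
    · simp; abel
    · intro b _ hb; simp [Pi.single_eq_of_ne hb]
    · simp
  have hc (i a b c : Fin 4) := hasDerivAt_trace_mul_mul τ (e a) (e b) (e c) (e i)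
    (g := fun s => Ring.inverse (x + s • e i)) (by simpa using hasDerivAt_inverse_add_smul h)
  have hd (i : Fin 4) : DifferentiableAt ℝ (fun y : Fin 4 → ℝ =>
      windingField τ e (Ring.inverse (∑ μ, y μ • e μ - S)) i) y :=
    DifferentiableAt.comp y (differentiable_windingField τ e i _)
      (differentiableAt_inverse_affine e S y h)
  have key (i : Fin 4) {r : ℝ}
      (hr : HasDerivAt (fun s : ℝ => windingField τ e (Ring.inverse (x + s • e i)) i) r 0) :
      fderiv ℝ (fun y : Fin 4 → ℝ =>
        windingField τ e (Ring.inverse (∑ μ, y μ • e μ - S)) i) y (Pi.single i 1) = r := by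
    rw [← (hd i).lineDeriv_eq_fderiv, lineDeriv]
    simp only [line]
    exact hr.deriv
  have r (a b c d : Fin 4) : τ (G * e a * (G * e b) * (G * e c) * (G * e d)) =
      τ (G * e d * (G * e a) * (G * e b) * (G * e c)) := by
    rw [hτ]; simp only [mul_assoc]
  rw [Fin.sum_univ_four, key 0 ((hc 0 1 2 3).sub (hc 0 1 3 2)),
    key 1 ((hc 1 0 3 2).sub (hc 1 0 2 3)), key 2 ((hc 2 0 1 3).sub (hc 2 0 3 1)),
    key 3 ((hc 3 0 2 1).sub (hc 3 0 1 2))]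
  simp only [zero_smul, add_zero]
  linarith [r 1 2 3 0, r 2 3 0 1, r 3 0 1 2, r 1 3 2 0, r 3 2 0 1, r 2 0 1 3,
    r 2 1 3 0, r 1 3 0 2, r 3 0 2 1, r 2 3 1 0, r 3 1 0 2, r 1 0 2 3,
    r 3 1 2 0, r 1 2 0 3, r 2 0 3 1, r 3 2 1 0, r 2 1 0 3, r 1 0 3 2]

open MeasureTheory in
/-- The outward flux of `f` through the boundary of the cube `[-1, 1]⁴`. -/
noncomputable def cubeFlux (f : Fin 4 → (Fin 4 → ℝ) → ℝ) : ℝ :=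
  ∑ i : Fin 4, ((∫ x in Set.Icc (fun _ : Fin 3 => (-1 : ℝ)) (fun _ => 1), f i (i.insertNth 1 x)) -
    ∫ x in Set.Icc (fun _ : Fin 3 => (-1 : ℝ)) (fun _ => 1), f i (i.insertNth (-1) x))

open MeasureTheory in
theorem cubeFlux_windingField_eq_zero (τ : A →L[ℝ] ℝ) (hτ : ∀ a b, τ (a * b) = τ (b * a))
    (e : Fin 4 → A) (S : A) (h : ∀ y : Fin 4 → ℝ, IsUnit (∑ μ, y μ • e μ - S)) :
    cubeFlux (fun i y => windingField τ e (Ring.inverse (∑ μ, y μ • e μ - S)) i) = 0 := by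
  have hd (i : Fin 4) : Differentiable ℝ (fun y : Fin 4 → ℝ =>
      windingField τ e (Ring.inverse (∑ μ, y μ • e μ - S)) i) := fun y =>
    DifferentiableAt.comp y (differentiable_windingField τ e i _)
      (differentiableAt_inverse_affine e S y (h y))
  have hz : (fun y : Fin 4 → ℝ => ∑ i, fderiv ℝ (fun y : Fin 4 → ℝ =>
      windingField τ e (Ring.inverse (∑ μ, y μ • e μ - S)) i) y (Pi.single i 1)) = fun _ => 0 :=
    funext fun y => sum_fderiv_windingField τ hτ e S y (h y)
  have := integral_divergence_of_hasFDerivAt_off_countable' (n := 3) (E := ℝ)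
    (fun _ => -1) (fun _ => 1) (fun _ => by norm_num)
    (fun i (y : Fin 4 → ℝ) => windingField τ e (Ring.inverse (∑ μ, y μ • e μ - S)) i)
    (fun i => fderiv ℝ _) ∅ Set.countable_empty (fun i => (hd i).continuous.continuousOn)
    (fun y _ i => (hd i y).hasFDerivAt) (by rw [hz]; exact integrableOn_zero)
  rw [hz] at this
  simpa [cubeFlux] using! this.symm

open MeasureTheory in
/-- Each face of the cube avoids the origin, so the inverses stay defined on the faces at
`t = 0`. -/
theorem continuous_cubeFlux_windingField (τ : A →L[ℝ] ℝ)
    (e : Fin 4 → A) (S : A)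
    (h : ∀ (t : ℝ) (y : Fin 4 → ℝ), y ≠ 0 → IsUnit (∑ μ, y μ • e μ - t • S)) :
    Continuous fun t : ℝ =>
      cubeFlux (fun i y => windingField τ e (Ring.inverse (∑ μ, y μ • e μ - t • S)) i) := by
  have face (i : Fin 4) (c : ℝ) (hc : c ≠ 0) : Continuous fun t : ℝ =>
      ∫ x in Set.Icc (fun _ : Fin 3 => (-1 : ℝ)) (fun _ => 1),
        windingField τ e (Ring.inverse (∑ μ,
          (i.insertNth c x : Fin 4 → ℝ) μ • e μ - t • S)) i := by
    refine continuous_parametric_integral_of_continuous (μ := volume) (f := fun t x =>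
      windingField τ e (Ring.inverse (∑ μ,
          (i.insertNth c x : Fin 4 → ℝ) μ • e μ - t • S)) i) ?_ isCompact_Icc
    refine (continuous_windingField τ e i).comp (continuous_iff_continuousAt.2 fun p => ?_)
    have hu : IsUnit (∑ μ, (i.insertNth c p.2 : Fin 4 → ℝ) μ • e μ - p.1 • S) :=
      h _ _ fun h0 => hc (by simpa using congrFun h0 i)
    have hcont : Continuous fun p : ℝ × (Fin 3 → ℝ) =>
        ∑ μ, (i.insertNth c p.2 : Fin 4 → ℝ) μ • e μ - p.1 • S := by
      have : Continuous fun p : ℝ × (Fin 3 → ℝ) => (i.insertNth c p.2 : Fin 4 → ℝ) :=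
        continuous_const.finInsertNth i continuous_snd
      fun_prop
    exact ContinuousAt.comp (f := fun p : ℝ × (Fin 3 → ℝ) =>
        ∑ μ, (i.insertNth c p.2 : Fin 4 → ℝ) μ • e μ - p.1 • S)
      (NormedRing.inverse_continuousAt hu.unit) hcont.continuousAt
  exact continuous_finsetSum _ fun i _ => (face i 1 one_ne_zero).sub (face i (-1) (by norm_num))

/-- By rescaling, all the families `∑ y_μ e_μ - t S` with `t ≠ 0` consist of units and have zero
flux, so the flux is still zero in the limit `t → 0`. -/
theorem cubeFlux_windingField_limit_eq_zero (τ : A →L[ℝ] ℝ) (hτ : ∀ a b, τ (a * b) = τ (b * a))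
    (e : Fin 4 → A) (S : A) (he : ∀ y : Fin 4 → ℝ, y ≠ 0 → IsUnit (∑ μ, y μ • e μ))
    (h : ∀ y : Fin 4 → ℝ, IsUnit (∑ μ, y μ • e μ - S)) :
    cubeFlux (fun i y => windingField τ e (Ring.inverse (∑ μ, y μ • e μ)) i) = 0 := by
  have hu (t : ℝ) (ht : t ≠ 0) (y : Fin 4 → ℝ) : IsUnit (∑ μ, y μ • e μ - t • S) := by
    have : ∑ μ, y μ • e μ - t • S =
        Units.mk0 t ht • (∑ μ, (t⁻¹ • y) μ • e μ - S) := by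
      simp [Units.smul_def, smul_sub, Finset.smul_sum, smul_smul, ht]
    rw [this]
    exact (h _).smul _
  have hcont := continuous_cubeFlux_windingField τ e S fun t y hy => by
    rcases eq_or_ne t 0 with rfl | ht
    · simpa using he y hy
    · exact hu t ht y
  have hzero : Set.EqOn (fun t : ℝ =>
      cubeFlux (fun i y => windingField τ e (Ring.inverse (∑ μ, y μ • e μ - t • S)) i))
      (fun _ => 0) {0}ᶜ := fun t ht =>
    cubeFlux_windingField_eq_zero τ hτ e (t • S) (hu t ht)
  have := congrFun (hcont.ext_on (dense_compl_singleton 0) continuous_const hzero) 0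
  simpa using this

end Winding

/-! ### The winding field of the quaternions -/

section Quat

/-- The real basis `1, i, j, k` of the quaternions. -/
def quaternionBasis : Fin 4 → ℍ[ℝ] := ![1, ⟨0, 1, 0, 0⟩, ⟨0, 0, 1, 0⟩, ⟨0, 0, 0, 1⟩]

theorem re_quaternionBasis (i : Fin 4) : (quaternionBasis i).re = ![1, 0, 0, 0] i := by
  fin_cases i <;> rfl

theorem imI_quaternionBasis (i : Fin 4) : (quaternionBasis i).imI = ![0, 1, 0, 0] i := by
  fin_cases i <;> rfl

theorem imJ_quaternionBasis (i : Fin 4) : (quaternionBasis i).imJ = ![0, 0, 1, 0] i := by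
  fin_cases i <;> rfl

theorem imK_quaternionBasis (i : Fin 4) : (quaternionBasis i).imK = ![0, 0, 0, 1] i := by
  fin_cases i <;> rfl

theorem sum_smul_quaternionBasis (y : Fin 4 → ℝ) :
    ∑ μ, y μ • quaternionBasis μ = ⟨y 0, y 1, y 2, y 3⟩ := by
  rw [Fin.sum_univ_four]
  ext <;> simp [re_quaternionBasis, imI_quaternionBasis, imJ_quaternionBasis, imK_quaternionBasis]

/-- With `r = |q|⁻²` this is the field at `q⁻¹`, namely `-2 q / |q|⁴`. -/
theorem windingField_quaternionBasis (f : ℍ[ℝ] →L[ℝ] ℝ) (hf : ∀ q, f q = q.re) (q : ℍ[ℝ])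
    (r : ℝ) (i : Fin 4) :
    windingField f quaternionBasis (r • star q) i =
      -(2 * r ^ 3 * Quaternion.normSq q * ![q.re, q.imI, q.imJ, q.imK] i) := by
  rw [Quaternion.normSq_def']
  fin_cases i <;> simp [windingField, hf, re_quaternionBasis, imI_quaternionBasis,
    imJ_quaternionBasis, imK_quaternionBasis] <;> ring
end Quat

/-! ### Left eigenvalues of quaternionic matrices -/

section Mat

attribute [local instance] Matrix.linftyOpNormedRing Matrix.linftyOpNormedAlgebra
variable {n : Type*} [Fintype n]

/-- The real part of the trace, a tracial functional on quaternionic matrices. -/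
noncomputable def Matrix.reTrace : Matrix n n ℍ[ℝ] →L[ℝ] ℝ :=
  LinearMap.toContinuousLinearMap
    { toFun := fun M => ∑ i, (M i i).re
      map_add' := fun M N => by simp [Finset.sum_add_distrib]
      map_smul' := fun r M => by simp [Finset.mul_sum] }

theorem Matrix.reTrace_apply (M : Matrix n n ℍ[ℝ]) : reTrace M = ∑ i, (M i i).re := rfl

theorem Quaternion.re_mul_comm (a b : ℍ[ℝ]) : (a * b).re = (b * a).re := by
  simp; ring

theorem Matrix.reTrace_mul_comm (M N : Matrix n n ℍ[ℝ]) : reTrace (M * N) = reTrace (N * M) := by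
  have (a : n → ℍ[ℝ]) : (∑ i, a i).re = ∑ i, (a i).re :=
    map_sum (QuaternionAlgebra.reₗ (-1 : ℝ) (0 : ℝ) (-1 : ℝ)) a Finset.univ
  simp only [reTrace_apply, Matrix.mul_apply, this]
  rw [Finset.sum_comm]
  simp only [Quaternion.re_mul_comm (M _ _)]

variable [DecidableEq n]

/-- The real part as a continuous linear functional. -/
noncomputable def Quaternion.reL : ℍ[ℝ] →L[ℝ] ℝ :=
  LinearMap.toContinuousLinearMap (QuaternionAlgebra.reₗ (-1 : ℝ) (0 : ℝ) (-1 : ℝ))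

theorem windingField_scalar (e : Fin 4 → ℍ[ℝ]) (p : ℍ[ℝ]) (i : Fin 4) :
    windingField Matrix.reTrace (fun μ => Matrix.scalar n (e μ)) (Matrix.scalar n p) i =
      Fintype.card n * windingField Quaternion.reL e p i := by
  have h (q : ℍ[ℝ]) : Matrix.reTrace (Matrix.scalar n q) = Fintype.card n * Quaternion.reL q := by
    simp [Matrix.reTrace_apply]; left; rfl
  have h' (a b c : Fin 4) : Matrix.reTrace (Matrix.scalar n p * Matrix.scalar n (e a) *
      (Matrix.scalar n p * Matrix.scalar n (e b)) * (Matrix.scalar n p * Matrix.scalar n (e c))) =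
      Fintype.card n * Quaternion.reL (p * e a * (p * e b) * (p * e c)) := by
    simp only [← map_mul]
    exact h _
  have h'' (a b c a' b' c' : Fin 4) :=
    (congrArg₂ (· - ·) (h' a b c) (h' a' b' c')).trans (mul_sub _ _ _).symm
  fin_cases i
  exacts [h'' 1 2 3 1 3 2, h'' 0 3 2 0 2 3, h'' 0 1 3 0 3 1, h'' 0 2 1 0 1 2]

theorem sum_smul_scalar_quaternionBasis (y : Fin 4 → ℝ) :
    ∑ μ, y μ • Matrix.scalar n (quaternionBasis μ) =
      Matrix.scalar n ⟨y 0, y 1, y 2, y 3⟩ := by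
  rw [← sum_smul_quaternionBasis, map_sum]
  refine Finset.sum_congr rfl fun μ _ => ?_
  exact (Matrix.diagonal_smul (y μ) fun _ => quaternionBasis μ).symm

theorem quaternion_mk_ne_zero {y : Fin 4 → ℝ} (hy : y ≠ 0) :
    (⟨y 0, y 1, y 2, y 3⟩ : ℍ[ℝ]) ≠ 0 := by
  intro h0
  apply hy
  rw [QuaternionAlgebra.ext_iff] at h0
  ext μ
  fin_cases μ
  exacts [h0.1, h0.2.1, h0.2.2.1, h0.2.2.2]

theorem windingField_inverse_scalar (y : Fin 4 → ℝ) (hy : y ≠ 0) (i : Fin 4) :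
    windingField Matrix.reTrace (fun μ => Matrix.scalar n (quaternionBasis μ))
      (Ring.inverse (∑ μ, y μ • Matrix.scalar n (quaternionBasis μ))) i =
      -(2 * Fintype.card n / (∑ μ, y μ ^ 2) ^ 2 * y i) := by
  set q : ℍ[ℝ] := ⟨y 0, y 1, y 2, y 3⟩
  have hN : Quaternion.normSq q = ∑ μ, y μ ^ 2 := by
    rw [Quaternion.normSq_def', Fin.sum_univ_four]
  have hq0 : q ≠ 0 := quaternion_mk_ne_zero hy
  have hN0 : ∑ μ, y μ ^ 2 ≠ 0 := by rw [← hN]; simpa using hq0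
  have hinv : Ring.inverse (Matrix.scalar n q) = Matrix.scalar n ((Quaternion.normSq q)⁻¹ • star q) :=
    Ring.inverse_unit (Units.map ((Matrix.scalar n : ℍ[ℝ] →+* Matrix n n ℍ[ℝ]) :
      ℍ[ℝ] →* Matrix n n ℍ[ℝ]) (Units.mk0 q hq0))
  rw [sum_smul_scalar_quaternionBasis, hinv, windingField_scalar,
    windingField_quaternionBasis _ (fun _ => rfl), hN]
  have : ![q.re, q.imI, q.imJ, q.imK] i = y i := by fin_cases i <;> rfl
  rw [this]
  field_simp

open MeasureTheory in
/-- Every nonempty square quaternionic matrix has a left eigenvalue. -/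
theorem exists_not_isUnit_sub_scalar [Nonempty n] (S : Matrix n n ℍ[ℝ]) :
    ∃ x : ℍ[ℝ], ¬ IsUnit (S - Matrix.scalar n x) := by
  by_contra! hS
  have : CompleteSpace (Matrix n n ℍ[ℝ]) := FiniteDimensional.complete ℝ _
  have h0 := cubeFlux_windingField_limit_eq_zero Matrix.reTrace Matrix.reTrace_mul_comm
    (fun μ => Matrix.scalar n (quaternionBasis μ)) S
    (fun y hy => by
      rw [sum_smul_scalar_quaternionBasis]
      exact (quaternion_mk_ne_zero hy).isUnit.map (Matrix.scalar n))
    (fun y => by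
      rw [sum_smul_scalar_quaternionBasis, ← IsUnit.neg_iff, neg_sub]
      exact hS _)
  -- On each of the eight faces the outward component of the field is `-h`.
  set h : (Fin 3 → ℝ) → ℝ := fun x => 2 * Fintype.card n / (1 + ∑ j, x j ^ 2) ^ 2
  have hpos (x : Fin 3 → ℝ) : 0 < 1 + ∑ j, x j ^ 2 := by positivity
  have hcard : (0 : ℝ) < Fintype.card n := by exact_mod_cast Fintype.card_pos
  have face (i : Fin 4) (c : ℝ) (hc : c ^ 2 = 1) (x : Fin 3 → ℝ) :
      windingField Matrix.reTrace (fun μ => Matrix.scalar n (quaternionBasis μ))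
        (Ring.inverse (∑ μ, (i.insertNth c x : Fin 4 → ℝ) μ •
          Matrix.scalar n (quaternionBasis μ))) i = -c * h x := by
    rw [windingField_inverse_scalar, i.sum_univ_succAbove]
    · simp [h, hc]; ring
    · intro h0
      have : c = 0 := by simpa using congrFun h0 i
      simp [this] at hc
  have hint : 0 < ∫ x in Set.Icc (fun _ : Fin 3 => (-1 : ℝ)) (fun _ => 1), h x := by
    have hh : Continuous h := by
      refine Continuous.div (by fun_prop) (by fun_prop) fun x => (pow_pos (hpos x) 2).ne'
    have hp (x) : 0 < h x := div_pos (by positivity) (pow_pos (hpos x) 2)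
    rw [setIntegral_pos_iff_support_of_nonneg_ae (Filter.Eventually.of_forall fun x => (hp x).le)
      (hh.continuousOn.integrableOn_compact isCompact_Icc)]
    have : Function.support h = Set.univ := Set.eq_univ_of_forall fun x => (hp x).ne'
    rw [this, Set.univ_inter, Real.volume_Icc_pi]
    norm_num
  simp only [cubeFlux, face _ 1 (by norm_num), face _ (-1) (by norm_num), neg_mul, one_mul,
    neg_neg, integral_neg] at h0
  simp at h0
  linarith
end Mat

/-! ### The action of `O(k)` on ADHM data -/

namespace ADHMSpace
variable {k : ℕ}

theorem smul_T (g : Matrix.orthogonalGroup (Fin k) ℝ) (d : ADHMSpace k) :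
    (g • d).T = toQuat g * d.T * toQuat (g⁻¹ : Matrix.orthogonalGroup (Fin k) ℝ) := rfl

theorem smul_P (g : Matrix.orthogonalGroup (Fin k) ℝ) (d : ADHMSpace k) :
    (g • d).P = toQuat g *ᵥ d.P := rfl

theorem toQuat_apply (D : Matrix (Fin k) (Fin k) ℝ) (i j : Fin k) :
    toQuat D i j = (D i j : ℍ[ℝ]) := rfl

theorem conjTranspose_toQuat (D : Matrix (Fin k) (Fin k) ℝ) : (toQuat D)ᴴ = toQuat Dᵀ := by
  ext1 i j
  simp [toQuat_apply]

theorem toQuat_mul_toQuat_inv (g : Matrix.orthogonalGroup (Fin k) ℝ) :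
    toQuat (g : Matrix (Fin k) (Fin k) ℝ) *
      toQuat (g⁻¹ : Matrix.orthogonalGroup (Fin k) ℝ) = 1 := by
  rw [← map_mul, ← Submonoid.coe_mul, mul_inv_cancel, Submonoid.coe_one, map_one]

theorem toQuat_inv_mul_toQuat (g : Matrix.orthogonalGroup (Fin k) ℝ) :
    toQuat (g⁻¹ : Matrix.orthogonalGroup (Fin k) ℝ) *
      toQuat (g : Matrix (Fin k) (Fin k) ℝ) = 1 := by
  rw [← map_mul, ← Submonoid.coe_mul, inv_mul_cancel, Submonoid.coe_one, map_one]

theorem toQuat_inv_eq (g : Matrix.orthogonalGroup (Fin k) ℝ) :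
    toQuat ((g⁻¹ : Matrix.orthogonalGroup (Fin k) ℝ) : Matrix (Fin k) (Fin k) ℝ) =
      (toQuat (g : Matrix (Fin k) (Fin k) ℝ))ᴴ := by
  rw [conjTranspose_toQuat]; rfl

theorem commute_toQuat_diagonal (D : Matrix (Fin k) (Fin k) ℝ) (x : ℍ[ℝ]) :
    toQuat D * Matrix.diagonal (fun _ => x) = Matrix.diagonal (fun _ => x) * toQuat D := by
  ext1 i j
  rw [Matrix.mul_diagonal, Matrix.diagonal_mul]
  exact Algebra.commutes (D i j) x

theorem smul_eq_self_iff (u : Matrix.orthogonalGroup (Fin k) ℝ) (d : ADHMSpace k) :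
    u • d = d ↔ toQuat u * d.T = d.T * toQuat u ∧ toQuat u *ᵥ d.P = d.P := by
  rw [ADHMSpace.ext_iff, smul_P, smul_T]
  refine and_congr_left fun _ => ⟨fun h => ?_, fun h => ?_⟩
  · conv_rhs => rw [← h, mul_assoc, toQuat_inv_mul_toQuat, mul_one]
  · rw [h, mul_assoc, toQuat_mul_toQuat_inv, mul_one]

/-- The formula for `R_x R_x*`, where `R_x* w = ((T - x) w, P* w)`. -/
theorem R_apply_mulVec (d : ADHMSpace k) (x : ℍ[ℝ]) (w : Fin k → ℍ[ℝ]) :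
    d.R x ((d.T - Matrix.diagonal fun _ => x) *ᵥ w, star d.P ⬝ᵥ w) =
      ((d.T - Matrix.diagonal fun _ => x)ᴴ * (d.T - Matrix.diagonal fun _ => x) +
        Matrix.vecMulVec d.P (star d.P)) *ᵥ w := by
  rw [R, Matrix.add_mulVec, Matrix.mulVec_mulVec]
  congr 1
  ext1 i
  simp [Matrix.mulVec, dotProduct, Matrix.vecMulVec_apply, Finset.mul_sum, mul_assoc]

/-- Equivariance of `R_x`: real matrices commute with the scalar matrix `x 1`. -/
theorem R_smul (g : Matrix.orthogonalGroup (Fin k) ℝ) (d : ADHMSpace k) (x : ℍ[ℝ])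
    (v : Fin k → ℍ[ℝ]) (q : ℍ[ℝ]) :
    (g • d).R x (toQuat g *ᵥ v, q) = toQuat g *ᵥ d.R x (v, q) := by
  have h : (g • d).T - Matrix.diagonal (fun _ => x) =
      toQuat g * (d.T - Matrix.diagonal fun _ => x) *
        toQuat (g⁻¹ : Matrix.orthogonalGroup (Fin k) ℝ) := by
    rw [mul_sub, sub_mul, commute_toQuat_diagonal, mul_assoc (Matrix.diagonal _),
      toQuat_mul_toQuat_inv, mul_one, smul_T]
  rw [R, R, h, toQuat_inv_eq, Matrix.mulVec_add, Matrix.conjTranspose_mul,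
    Matrix.conjTranspose_mul, Matrix.conjTranspose_conjTranspose, ← toQuat_inv_eq]
  congr 1
  · simp only [Matrix.mulVec_mulVec]
    congr 1
    simp only [Matrix.mul_assoc]
    rw [toQuat_inv_mul_toQuat, Matrix.mul_one]
  · ext1 i
    simp [smul_P, Matrix.mulVec, dotProduct, Finset.sum_mul, mul_assoc]

theorem Nondegenerate.smul {d : ADHMSpace k} (hd : d.Nondegenerate)
    (g : Matrix.orthogonalGroup (Fin k) ℝ) : (g • d).Nondegenerate := by
  intro x z
  obtain ⟨⟨v, q⟩, hv⟩ := hd x (toQuat (g⁻¹ : Matrix.orthogonalGroup (Fin k) ℝ) *ᵥ z)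
  refine ⟨(toQuat g *ᵥ v, q), ?_⟩
  rw [R_smul, hv, Matrix.mulVec_mulVec, toQuat_mul_toQuat_inv, Matrix.one_mulVec]

theorem satisfiesADHM_iff_exists_toQuat {d : ADHMSpace k} : d.SatisfiesADHM ↔
    ∃ D, d.Tᴴ * d.T + Matrix.vecMulVec d.P (star d.P) = toQuat D := by
  constructor
  · intro h
    refine ⟨Matrix.of fun i j => ((d.Tᴴ * d.T + Matrix.vecMulVec d.P (star d.P)) i j).re, ?_⟩
    ext1 i j
    rw [toQuat_apply, Matrix.of_apply]
    conv_lhs => rw [← Quaternion.re_add_im ((d.Tᴴ * d.T + Matrix.vecMulVec d.P (star d.P)) i j),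
      h i j, add_zero]
  · rintro ⟨D, hD⟩ i j
    rw [hD, toQuat_apply]
    simp

theorem SatisfiesADHM.smul {d : ADHMSpace k} (hd : d.SatisfiesADHM)
    (g : Matrix.orthogonalGroup (Fin k) ℝ) : (g • d).SatisfiesADHM := by
  rw [satisfiesADHM_iff_exists_toQuat] at hd ⊢
  obtain ⟨D, hD⟩ := hd
  refine ⟨(g : Matrix (Fin k) (Fin k) ℝ) * D *
    (g⁻¹ : Matrix.orthogonalGroup (Fin k) ℝ), ?_⟩
  have hP : Matrix.vecMulVec (g • d).P (star (g • d).P) =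
      toQuat g * Matrix.vecMulVec d.P (star d.P) *
        toQuat (g⁻¹ : Matrix.orthogonalGroup (Fin k) ℝ) := by
    rw [Matrix.mul_vecMulVec, Matrix.vecMulVec_mul, smul_P, Matrix.star_mulVec, toQuat_inv_eq]
  have hT : (g • d).Tᴴ * (g • d).T = toQuat g * (d.Tᴴ * d.T) *
      toQuat (g⁻¹ : Matrix.orthogonalGroup (Fin k) ℝ) := by
    have h1 : (g • d).Tᴴ =
        toQuat g * d.Tᴴ * toQuat (g⁻¹ : Matrix.orthogonalGroup (Fin k) ℝ) := by
      rw [smul_T, Matrix.conjTranspose_mul, Matrix.conjTranspose_mul, toQuat_inv_eq,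
        Matrix.conjTranspose_conjTranspose, mul_assoc]
    rw [h1, smul_T]
    simp only [mul_assoc]
    rw [← mul_assoc (toQuat _) (toQuat _) (d.T * _), toQuat_inv_mul_toQuat, one_mul]
  rw [hP, hT, ← add_mul, ← mul_add, hD, map_mul, map_mul]

/-- The ADHM condition is invariant under `T ↦ T - x`: as `T` is symmetric, the entries of the cross
term `T* x + x̄ T` are of the form `t̄ x + x̄ t`, hence real. -/
theorem SatisfiesADHM.exists_toQuat_eq_adjoint_mul {d : ADHMSpace k} (hd : d.SatisfiesADHM)
    (x : ℍ[ℝ]) : ∃ D, (d.T - Matrix.diagonal fun _ => x)ᴴ * (d.T - Matrix.diagonal fun _ => x) +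
      Matrix.vecMulVec d.P (star d.P) = toQuat D := by
  obtain ⟨D, hD⟩ := satisfiesADHM_iff_exists_toQuat.1 hd
  refine ⟨D - Matrix.of (fun i j => 2 * (star x * d.T i j).re) +
    Matrix.diagonal fun _ => Quaternion.normSq x, ?_⟩
  rw [map_add, map_sub, ← hD]
  have hsymm (i j) : d.T i j = d.T j i := d.symm.apply j i
  have cross : d.Tᴴ * Matrix.diagonal (fun _ => x) + Matrix.diagonal (fun _ => star x) * d.T =
      toQuat (Matrix.of fun i j => 2 * (star x * d.T i j).re) := by
    ext1 i j
    rw [Matrix.add_apply, Matrix.mul_diagonal, Matrix.diagonal_mul, toQuat_apply, Matrix.of_apply,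
      Matrix.conjTranspose_apply, ← hsymm]
    ext <;> simp <;> ring
  have hx : Matrix.diagonal (fun _ => star x) * Matrix.diagonal (fun _ => x) =
      toQuat (Matrix.diagonal fun _ : Fin k => Quaternion.normSq x) := by
    rw [Matrix.diagonal_mul_diagonal]
    ext1 i j
    rw [toQuat_apply, Quaternion.star_mul_self]
    by_cases h : i = j <;> simp [h]
  rw [← cross, ← hx, Matrix.conjTranspose_sub, Matrix.diagonal_conjTranspose]
  change (_ - Matrix.diagonal fun _ => star x) * _ + _ = _
  noncomm_ring

/-! ### Degenerate ADHM data are fixed by a reflection -/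

theorem exists_real_kernel {d : ADHMSpace k} (hd : d.SatisfiesADHM) (h : ¬ d.Nondegenerate) :
    ∃ (x : ℍ[ℝ]) (w : Fin k → ℝ), w ≠ 0 ∧ (∀ i, ∑ j, d.T i j * (w j : ℍ[ℝ]) = x * w i) ∧
      ∑ i, (w i : ℍ[ℝ]) * d.P i = 0 := by
  simp only [Nondegenerate, not_forall] at h
  obtain ⟨x, hx⟩ := h
  obtain ⟨D, hD⟩ := hd.exists_toQuat_eq_adjoint_mul x
  -- If `D` is invertible, then `R_x R_x*` is onto and hence so is `R_x`.
  have hdet : D.det = 0 := by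
    by_contra hdet
    refine hx fun z => ⟨_, R_apply_mulVec d x (toQuat D⁻¹ *ᵥ z) |>.trans ?_⟩
    rw [hD, Matrix.mulVec_mulVec, ← map_mul, Matrix.mul_nonsing_inv _ (isUnit_iff_ne_zero.2 hdet),
      map_one, Matrix.one_mulVec]
  obtain ⟨w, hw0, hw⟩ := Matrix.exists_mulVec_eq_zero_iff.2 hdet
  set W : Fin k → ℍ[ℝ] := fun i => (w i : ℍ[ℝ]) with hW
  set B := d.T - Matrix.diagonal fun _ => x with hB
  have hDW : toQuat D *ᵥ W = 0 := by
    ext1 i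
    have := congrArg (algebraMap ℝ ℍ[ℝ]) (congrFun hw i)
    simpa [Matrix.mulVec, dotProduct, toQuat_apply, hW] using this
  -- `0 = w* D w = |(T - x) w|² + |P* w|²`.
  have hsum : ∑ i, Quaternion.normSq ((B *ᵥ W) i) + Quaternion.normSq (star d.P ⬝ᵥ W) = 0 := by
    have h0 : star W ⬝ᵥ (toQuat D *ᵥ W) = 0 := by rw [hDW, dotProduct_zero]
    rw [← hD, Matrix.add_mulVec, dotProduct_add, ← Matrix.mulVec_mulVec, Matrix.dotProduct_mulVec,
      ← Matrix.star_mulVec] at h0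
    have h1 : star W ⬝ᵥ (Matrix.vecMulVec d.P (star d.P) *ᵥ W) =
        star (star d.P ⬝ᵥ W) * (star d.P ⬝ᵥ W) := by
      rw [← Matrix.star_dotProduct_star, star_star]
      simp only [Matrix.mulVec, dotProduct, Matrix.vecMulVec_apply, Finset.sum_mul,
        Finset.mul_sum, mul_assoc]
      exact Finset.sum_comm
    rw [h1, Quaternion.star_mul_self] at h0
    simp only [dotProduct, Pi.star_apply, Quaternion.star_mul_self] at h0
    refine (algebraMap ℝ ℍ[ℝ]).injective ?_
    rw [map_add, map_sum, map_zero]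
    exact h0
  have hnn : ∀ i ∈ Finset.univ, 0 ≤ Quaternion.normSq ((B *ᵥ W) i) :=
    fun _ _ => Quaternion.normSq_nonneg
  rw [add_eq_zero_iff_of_nonneg (Finset.sum_nonneg hnn) Quaternion.normSq_nonneg,
    Finset.sum_eq_zero_iff_of_nonneg hnn] at hsum
  refine ⟨x, w, hw0, fun i => ?_, ?_⟩
  · have := Quaternion.normSq_eq_zero.1 (hsum.1 i (Finset.mem_univ i))
    rw [hB, Matrix.sub_mulVec, Pi.sub_apply, Matrix.mulVec_diagonal, sub_eq_zero] at this
    exact this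
  · have := congrArg star (Quaternion.normSq_eq_zero.1 hsum.2)
    simpa [dotProduct, hW] using this

theorem exists_reflection_smul_eq {d : ADHMSpace k} {x : ℍ[ℝ]} {w : Fin k → ℝ} (hw : w ≠ 0)
    (hT : ∀ i, ∑ j, d.T i j * (w j : ℍ[ℝ]) = x * w i) (hP : ∑ i, (w i : ℍ[ℝ]) * d.P i = 0) :
    ∃ u : Matrix.orthogonalGroup (Fin k) ℝ, u ≠ 1 ∧ u • d = d := by
  have hN : w ⬝ᵥ w ≠ 0 := fun h => hw (dotProduct_self_eq_zero.1 h)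
  -- The reflection is `1 - W` with `W = (2 / |w|²) w wᵀ`.
  set c : ℝ := 2 / (w ⬝ᵥ w)
  have hcN : c * (w ⬝ᵥ w) = 2 := div_mul_cancel₀ _ hN
  set W : Matrix (Fin k) (Fin k) ℝ := c • Matrix.vecMulVec w w with hW
  have hWt : Wᵀ = W := by rw [hW, Matrix.transpose_smul, Matrix.transpose_vecMulVec]
  have hWW : W * W = (2 : ℝ) • W := by
    rw [hW, Matrix.smul_mul, Matrix.mul_smul, Matrix.vecMulVec_mul_vecMulVec,
      Matrix.vecMulVec_smul, ← hcN]
    module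
  have hu : 1 - W ∈ Matrix.orthogonalGroup (Fin k) ℝ := by
    rw [Matrix.mem_orthogonalGroup_iff]
    rw [Matrix.transpose_sub, Matrix.transpose_one, hWt]
    calc (1 - W) * (1 - W) = 1 - (2 : ℝ) • W + W * W := by
          rw [two_smul]; noncomm_ring
      _ = 1 := by rw [hWW]; abel
  have hWapp (i j) : toQuat W i j = (w i : ℍ[ℝ]) * (c * w j) := by
    rw [toQuat_apply, hW, Matrix.smul_apply, Matrix.vecMulVec_apply, ← Quaternion.coe_mul,
      ← Quaternion.coe_mul, smul_eq_mul]
    congr 1; ring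
  refine ⟨⟨1 - W, hu⟩, fun h => hw ?_, (smul_eq_self_iff _ _).2 ⟨?_, ?_⟩⟩
  · have h1 : W = 0 := by simpa using congrArg Subtype.val h
    have h2 : W *ᵥ w = (c * (w ⬝ᵥ w)) • w := by
      ext1 i
      simp [hW, Matrix.smul_mulVec, Matrix.vecMulVec_mulVec]
      ring
    rw [h1, Matrix.zero_mulVec, hcN] at h2
    simpa using h2.symm
  · change toQuat (1 - W) * d.T = d.T * toQuat (1 - W)
    rw [map_sub, map_one, sub_mul, mul_sub, one_mul, mul_one]
    congr 1
    ext1 i j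
    have hl : ∑ a, (w a : ℍ[ℝ]) * d.T a j = x * w j := by
      rw [← hT j]
      exact Finset.sum_congr rfl fun a _ => by
        rw [d.symm.apply a j]; exact Algebra.commutes (w a) _
    simp only [Matrix.mul_apply, hWapp]
    calc ∑ a, (w i : ℍ[ℝ]) * (c * w a) * d.T a j = w i * (c * ∑ a, (w a : ℍ[ℝ]) * d.T a j) := by
          simp only [Finset.mul_sum, mul_assoc]
      _ = (∑ a, d.T i a * (w a : ℍ[ℝ])) * (c * w j) := by
          rw [hl, hT]
          ext <;> simp <;> ring
      _ = _ := by simp only [Finset.sum_mul, mul_assoc]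
  · change toQuat (1 - W) *ᵥ d.P = d.P
    rw [map_sub, map_one, Matrix.sub_mulVec, Matrix.one_mulVec, sub_eq_self]
    ext1 i
    simp only [Matrix.mulVec, dotProduct, hWapp, mul_assoc, ← Finset.mul_sum, hP, mul_zero,
      Pi.zero_apply]

/-! ### Data with nontrivial stabiliser -/

theorem splits_of_smul_eq {d : ADHMSpace k} {u : Matrix.orthogonalGroup (Fin k) ℝ} (hu : u ≠ 1)
    (h : u • d = d) : d.Splits := by
  have h' : u⁻¹ • d = d := inv_smul_eq_iff.2 h.symm
  obtain ⟨hT, hP⟩ := (smul_eq_self_iff u d).1 h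
  obtain ⟨hT', hP'⟩ := (smul_eq_self_iff _ d).1 h'
  set U : Matrix (Fin k) (Fin k) ℝ := u.1
  have hUinv : ((u⁻¹ : Matrix.orthogonalGroup (Fin k) ℝ) : Matrix (Fin k) (Fin k) ℝ) = Uᵀ := rfl
  rw [hUinv] at hT' hP'
  set K : Matrix (Fin k) (Fin k) ℝ := (1 - U) + (1 - Uᵀ) with hK
  have hKT : toQuat K * d.T = d.T * toQuat K := by
    simp only [hK, map_add, map_sub, map_one, add_mul, mul_add, sub_mul, mul_sub, hT, hT', one_mul,
      mul_one]
  have hKP : toQuat K *ᵥ d.P = 0 := by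
    simp only [hK, map_add, map_sub, map_one, Matrix.add_mulVec, Matrix.sub_mulVec,
      Matrix.one_mulVec, hP, hP', sub_self, add_zero]
  -- `K = (1 - u)ᵀ (1 - u)`.
  have hK0 : K ≠ 0 := by
    intro h0
    apply hu
    have hUU : Uᵀ * U = 1 := (Matrix.mem_orthogonalGroup_iff' (Fin k) ℝ).1 u.2
    have : (U - 1)ᴴ * (U - 1) = 0 := by
      rw [Matrix.conjTranspose_eq_transpose_of_trivial, Matrix.transpose_sub,
        Matrix.transpose_one, sub_mul, mul_sub, mul_sub, hUU, ← h0, hK]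
      noncomm_ring
    exact Subtype.ext (sub_eq_zero.1 (Matrix.conjTranspose_mul_self_eq_zero.1 this))
  have hKh : K.IsHermitian := by
    rw [Matrix.IsHermitian, Matrix.conjTranspose_eq_transpose_of_trivial, hK]
    simp only [Matrix.transpose_add, Matrix.transpose_sub, Matrix.transpose_transpose,
      Matrix.transpose_one, add_comm]
  set g : Matrix.orthogonalGroup (Fin k) ℝ := star hKh.eigenvectorUnitary
  set ev := hKh.eigenvalues
  have hdiag : (g : Matrix (Fin k) (Fin k) ℝ) * K *
      (g⁻¹ : Matrix.orthogonalGroup (Fin k) ℝ) = Matrix.diagonal ev :=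
    hKh.conjStarAlgAut_star_eigenvectorUnitary
  have hgK : (g : Matrix (Fin k) (Fin k) ℝ) * K = Matrix.diagonal ev * g := by
    rw [← hdiag, mul_assoc, ← Submonoid.coe_mul, inv_mul_cancel, Submonoid.coe_one, mul_one]
  have hKg : K * (g⁻¹ : Matrix.orthogonalGroup (Fin k) ℝ) =
      (g⁻¹ : Matrix.orthogonalGroup (Fin k) ℝ) * Matrix.diagonal ev := by
    rw [← hdiag, mul_assoc, ← mul_assoc, ← Submonoid.coe_mul, inv_mul_cancel, Submonoid.coe_one,
      one_mul]
  have hevT (i j) : (ev i : ℍ[ℝ]) * (g • d).T i j = (g • d).T i j * ev j := by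
    have : toQuat (Matrix.diagonal ev) * (g • d).T = (g • d).T * toQuat (Matrix.diagonal ev) := by
      rw [smul_T]
      calc toQuat (Matrix.diagonal ev) * (toQuat g * d.T * toQuat _) =
            toQuat (Matrix.diagonal ev * (g : Matrix (Fin k) (Fin k) ℝ)) * d.T *
              toQuat (g⁻¹ : Matrix.orthogonalGroup (Fin k) ℝ) := by
            rw [map_mul]; simp only [mul_assoc]
        _ = toQuat g * d.T *
            toQuat (K * ((g⁻¹ : Matrix.orthogonalGroup (Fin k) ℝ) : Matrix (Fin k) (Fin k) ℝ)) := by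
            rw [← hgK, map_mul, mul_assoc _ (toQuat K), hKT, map_mul]
            simp only [mul_assoc]
        _ = _ := by rw [hKg, map_mul, mul_assoc, mul_assoc, mul_assoc]
    have h2 : toQuat (Matrix.diagonal ev) = Matrix.diagonal fun i => (ev i : ℍ[ℝ]) :=
      Matrix.diagonal_map (map_zero (algebraMap ℝ ℍ[ℝ]))
    have h3 := congrFun (congrFun this i) j
    rwa [h2, Matrix.diagonal_mul, Matrix.mul_diagonal] at h3
  have hevP (i) : (ev i : ℍ[ℝ]) * (g • d).P i = 0 := by
    have : toQuat (Matrix.diagonal ev) *ᵥ (g • d).P = 0 := by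
      rw [smul_P, Matrix.mulVec_mulVec, ← map_mul, ← hgK, map_mul, ← Matrix.mulVec_mulVec, hKP,
        Matrix.mulVec_zero]
    have h2 : toQuat (Matrix.diagonal ev) = Matrix.diagonal fun i => (ev i : ℍ[ℝ]) :=
      Matrix.diagonal_map (map_zero (algebraMap ℝ ℍ[ℝ]))
    have h3 := congrFun this i
    rwa [h2, Matrix.mulVec_diagonal] at h3
  -- The zero eigenvalues index the block of `T'`, the nonzero ones that of `T''`.
  let p : Fin k → Prop := fun i => ev i = 0
  classical
  let e : Fin (Fintype.card {i // p i}) ⊕ Fin (Fintype.card {i // ¬ p i}) ≃ Fin k :=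
    (Equiv.sumCongr (Fintype.equivFin _).symm (Fintype.equivFin _).symm).trans (Equiv.sumCompl p)
  have hl (i) : ev (e (Sum.inl i)) = 0 := ((Fintype.equivFin {i // p i}).symm i).2
  have hr (i) : (ev (e (Sum.inr i)) : ℍ[ℝ]) ≠ 0 :=
    (map_ne_zero (algebraMap ℝ ℍ[ℝ])).2 ((Fintype.equivFin {i // ¬ p i}).symm i).2
  refine ⟨_, _, e, g, ⟨(g • d).T.submatrix (e ∘ Sum.inl) (e ∘ Sum.inl), (g • d).symm.submatrix _,
    (g • d).P ∘ e ∘ Sum.inl⟩, (g • d).T.submatrix (e ∘ Sum.inr) (e ∘ Sum.inr), ?_,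
    (g • d).symm.submatrix _, ?_, ?_⟩
  · rw [Fintype.card_pos_iff]
    by_contra hne
    rw [not_nonempty_iff] at hne
    refine hK0 (hKh.eigenvalues_eq_zero_iff.1 (funext fun i => ?_))
    by_contra hi
    exact hne.false ⟨i, hi⟩
  · ext1 i j
    rcases i with i | i <;> rcases j with j | j
    · rfl
    · have := hevT (e (Sum.inl i)) (e (Sum.inr j))
      simpa [hl, hr] using this
    · have := hevT (e (Sum.inr i)) (e (Sum.inl j))
      simpa [hl, hr] using this
    · rfl
  · ext1 i
    rcases i with i | i
    · rfl
    · simpa [hr] using hevP (e (Sum.inr i))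

/-- For `x` a left eigenvalue of `T''*` the map `R_{x̄}` is not onto: its component along the second
block is `T''* - x`. -/
theorem Splits.not_nondegenerate {d : ADHMSpace k} (h : d.Splits) : ¬ d.Nondegenerate := by
  obtain ⟨l, m, e, g, d', T'', hm, -, hT, hP⟩ := h
  intro hd
  have : Nonempty (Fin m) := ⟨⟨0, hm⟩⟩
  obtain ⟨x, hx⟩ := exists_not_isUnit_sub_scalar T''ᴴ
  refine hx ?_
  have hsurj (z : Fin m → ℍ[ℝ]) : ∃ v, (T''ᴴ - Matrix.scalar (Fin m) x) *ᵥ v = z := by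
    obtain ⟨⟨v, q⟩, hv⟩ := hd.smul g (star x) (Sum.elim 0 z ∘ e.symm)
    refine ⟨fun i => v (e (Sum.inr i)), funext fun i => ?_⟩
    have hTe (a b) : (g • d).T (e a) (e b) = Matrix.fromBlocks d'.T 0 0 T'' a b :=
      congrFun (congrFun hT a) b
    have h1 := congrFun hv (e (Sum.inr i))
    have hPi : (g • d).P (e (Sum.inr i)) = 0 := congrFun hP (Sum.inr i)
    simp only [R, Pi.add_apply, hPi, zero_mul, add_zero, Function.comp_apply,
      Equiv.symm_apply_apply, Sum.elim_inr] at h1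
    rw [← h1, Matrix.mulVec, Matrix.mulVec, dotProduct, dotProduct, ← e.sum_comp,
      Fintype.sum_sum_type]
    simp [hTe, Matrix.diagonal_apply, apply_ite star, eq_comm]
  choose v hv using fun j : Fin m => hsurj (Pi.single j 1)
  refine IsUnit.of_mul_eq_one (Matrix.of fun i j => v j i) ?_
  ext1 i j
  refine (congrFun (hv j) i).trans ?_
  simp [Matrix.one_apply, Pi.single_apply]

end ADHMSpace

theorem mainTheorem5 (k : ℕ) :
    (∀ (d : ADHMSpace k) (u : Matrix.orthogonalGroup (Fin k) ℝ), u ≠ 1 → u • d = d →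
      d.Splits ∧ ¬ d.Nondegenerate) ∧
    (∀ d : ADHMSpace k, d.SatisfiesADHM →
      (d.Nondegenerate ↔ MulAction.stabilizer (Matrix.orthogonalGroup (Fin k) ℝ) d = ⊥)) ∧
    (∀ (g : Matrix.orthogonalGroup (Fin k) ℝ), ∀ d ∈ ADHMSpace.nondegenerateData k,
      g • d ∈ ADHMSpace.nondegenerateData k) ∧
    (∀ d ∈ ADHMSpace.nondegenerateData k, ∀ g h : Matrix.orthogonalGroup (Fin k) ℝ,
      g • d = h • d → g = h) := by
  have key (d : ADHMSpace k) (hd : d.Nondegenerate) (u : Matrix.orthogonalGroup (Fin k) ℝ)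
      (hu : u • d = d) : u = 1 := by
    by_contra h
    exact (ADHMSpace.splits_of_smul_eq h hu).not_nondegenerate hd
  refine ⟨fun d u hu h => ?_, fun d hd => ⟨fun hn => ?_, fun hs => ?_⟩, fun g d hd =>
    ⟨hd.1.smul g, hd.2.smul g⟩, fun d hd g h hgh => ?_⟩
  · have hs := ADHMSpace.splits_of_smul_eq hu h
    exact ⟨hs, hs.not_nondegenerate⟩
  · exact (Subgroup.eq_bot_iff_forall _).2 fun u hu => key d hn u hu
  · by_contra hn
    obtain ⟨x, w, hw, hT, hP⟩ := ADHMSpace.exists_real_kernel hd hn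
    obtain ⟨u, hu, hud⟩ := ADHMSpace.exists_reflection_smul_eq hw hT hP
    exact hu ((Subgroup.eq_bot_iff_forall _).1 hs u hud)
  · have : (h⁻¹ * g) • d = d := by rw [mul_smul, hgh, inv_smul_smul]
    exact (inv_mul_eq_one.1 (key d hd.2 _ this)).symm
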